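/- For $n\ge 0$ let $$P_n=\sum_{k=0}^n\frac{\binom{2k}{k}^2\binom{2(n-k)}{n-k}^2}{\binom nk}$$ be the $n$-th Catalan–Larcombe–French number, and let the Euler numbers be defined by $E_0=1$ and $E_n=-\sum_{k=1}^{\lfloor n/2\rfloor}\binom{n}{2k}E_{n-2k}$ for $n\ge 1$. Then for every odd prime $p$, $$\sum_{k=0}^{p-1}\frac{P_k}{8^k}\equiv 1+2\left(\frac{-1}{p}\right)p^2E_{p-3}\pmod{p^3}$$ and $$\sum_{k=0}^{p-1}\frac{P_k}{16^k}\equiv\left(\frac{-1}{p}\right)-p^2E_{p-3}\pmod{p^3},$$ where $\left(\frac{\cdot}{p}\right)$ is the Legendre symbol and, for rational numbers $a,b$, $a\equiv b\pmod{p^3}$ means that $(a-b)/p^3$ is a rational number whose reduced denominator is not divisible by $p$. -/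

import Mathlib

/-- The `n`-th Catalan–Larcombe–French number
`P_n = ∑_{k=0}^n C(2k,k)^2 C(2(n-k),n-k)^2 / C(n,k)`, as a rational number. -/
def catalanLarcombeFrench (n : ℕ) : ℚ :=
  ∑ k ∈ Finset.range (n + 1),
    ((2 * k).choose k : ℚ) ^ 2 * ((2 * (n - k)).choose (n - k) : ℚ) ^ 2 / (n.choose k : ℚ)

/-- The Euler numbers: `E_0 = 1` and, for `n ≥ 1`,
`E_n = - ∑_{k=1}^{⌊n/2⌋} C(n,2k) E_{n-2k}`. -/
def eulerNumber : ℕ → ℤ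
  | 0 => 1
  | n + 1 => -∑ k ∈ (Finset.Icc 1 ((n + 1) / 2)).attach,
      ((n + 1).choose (2 * k.1) : ℤ) * eulerNumber (n + 1 - 2 * k.1)
  decreasing_by
    have h := Finset.mem_Icc.mp k.2
    omega

/-- Congruence of rational numbers modulo `m`: the difference `a - b` is `m` times a rational
number whose reduced denominator is coprime to `m`. For `m = p ^ r` with `p` prime and `r ≥ 1`
this says that `a - b` lies in `p ^ r ℤ_(p)`, where `ℤ_(p)` is the ring of `p`-integral
rational numbers. -/
def RatModEq (m : ℕ) (a b : ℚ) : Prop :=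
  ∃ c : ℚ, c.den.Coprime m ∧ a - b = (m : ℚ) * c

/-! Telescoping recurrences identify $P_n$ with $2^n\sum_k\binom{2k}{k}^2\binom{k}{n-k}(-4)^{n-k}$.
Regrouping by $k$ (`sum_catalanLarcombeFrench`) turns $\sum_{n<p}P_nz^n$ into a sum of
$\binom{2k}{k}^2(2z)^k$ times a truncation of $(1-8z)^k$. Let $p=2m+1\ge5$. For $m<k<p$ the factor
$\binom{2k}{k}^2$ is divisible by $p^2$, so the truncations there matter only modulo $p$.

At $z=1/8$ the truncation is an alternating partial sum of a binomial row, hence a single binomial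
coefficient. Only $k=0$ and $k=2m-i$ with $i<m$ survive. Modulo $p$, the latter terms divided by
$p^2$ are $(-1)^{i+1}/\bigl(2(i+1)^2\binom{m}{i+1}\bigr)$ (`clfTail_locModEq`). An exact identity
reduces their sum to half sums of $1/j^2$ and $(-1)^j/j^2$; the first vanishes and the second is
$2(-1)^mE_{p-3}$ modulo $p$.

At $z=1/16$ each truncation of $(1-1/2)^k$ may be completed, leaving
$\sum_{k<p}\binom{2k}{k}^2/16^k$. This is the value at $a=-1/2$ of $F(a)=\sum_{k<p}\binom
ak\binom{-1-a}k$, which satisfies $F(a)+F(a-1)=2\prod_{i<p}(1-a^2/i^2)$. Wolstenholme-type sums give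
$F(-p/2)\equiv1$ modulo $p^3$, and $m$ unit steps lead from $-p/2$ to $-1/2$, each contributing a
multiple of $p^2/j^2$; the same alternating sum appears. -/

/-! ### Recurrences and the second formula for $P_n$ -/

/-- The weights `C(2k,k)^2 k!`, whose self-convolution is `n! P_n`. -/
def clfWeight (k : ℕ) : ℚ := ((2 * k).choose k : ℚ) ^ 2 * (k.factorial : ℚ)

theorem centralBinom_succ_rat (k : ℕ) :
    ((2 * (k + 1)).choose (k + 1) : ℚ) = 2 * (2 * k + 1) / (k + 1) * ((2 * k).choose k : ℚ) := by
  have h := Nat.succ_mul_centralBinom_succ k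
  simp only [Nat.centralBinom_eq_two_mul_choose] at h
  have h' : ((k : ℚ) + 1) * ((2 * (k + 1)).choose (k + 1) : ℚ)
      = 2 * (2 * k + 1) * ((2 * k).choose k : ℚ) := by exact_mod_cast h
  field_simp
  linarith

theorem clfWeight_succ (k : ℕ) :
    clfWeight (k + 1) = 4 * (2 * k + 1) ^ 2 / (k + 1) * clfWeight k := by
  unfold clfWeight
  rw [centralBinom_succ_rat, Nat.factorial_succ]
  push_cast
  field_simp
  ring

theorem clfWeight_zero : clfWeight 0 = 1 := by simp [clfWeight]

theorem factorial_mul_catalanLarcombeFrench (n : ℕ) :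
    (n.factorial : ℚ) * catalanLarcombeFrench n
      = ∑ k ∈ Finset.range (n + 1), clfWeight k * clfWeight (n - k) := by
  unfold catalanLarcombeFrench clfWeight
  rw [Finset.mul_sum]
  refine Finset.sum_congr rfl fun k hk => ?_
  have hk' : k ≤ n := Nat.lt_succ_iff.mp (Finset.mem_range.mp hk)
  rw [Nat.cast_choose ℚ hk']
  have h1 : (n.factorial : ℚ) ≠ 0 := by exact_mod_cast n.factorial_ne_zero
  have h2 : (k.factorial : ℚ) ≠ 0 := by exact_mod_cast k.factorial_ne_zero
  have h3 : ((n - k).factorial : ℚ) ≠ 0 := by exact_mod_cast (n - k).factorial_ne_zero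
  field_simp

/-- Creative telescoping: the right side is the certificate, so induction on `K` is a
rational-function check. Stopping at `K ≤ n` keeps every natural subtraction exact. -/
theorem clfWeight_convolution_partial (n K : ℕ) (hK : K ≤ n) :
    ∑ k ∈ Finset.range K,
      ((n + 1) * (clfWeight k * clfWeight (n + 1 - k))
        - 8 * (3 * n ^ 2 + 3 * n + 1) * (clfWeight k * clfWeight (n - k))
        + 128 * n ^ 3 * (clfWeight k * clfWeight (n - 1 - k)))
      = 4 * K * (2 * (n + 1) * (n - K + 1) - 1) / (n - K + 1)
        * (clfWeight K * clfWeight (n - K)) := by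
  induction K with
  | zero => simp
  | succ k ih =>
    rw [Finset.sum_range_succ, ih (by omega)]
    obtain ⟨l, rfl⟩ : ∃ l, n = k + 1 + l := ⟨n - (k + 1), by omega⟩
    rw [show k + 1 + l + 1 - k = l + 1 + 1 by omega, show k + 1 + l - k = l + 1 by omega,
      show k + 1 + l - 1 - k = l by omega, show k + 1 + l - (k + 1) = l by omega]
    simp only [clfWeight_succ]
    push_cast
    rw [show (k : ℚ) + 1 + l - k + 1 = l + 2 by ring, show (k : ℚ) + 1 + l - (k + 1) + 1 = l + 1 by ring]
    rw [show (l : ℚ) + 1 + 1 = l + 2 by ring]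
    field_simp
    ring

theorem clfWeight_convolution_rec (n : ℕ) :
    (n + 2) * ∑ k ∈ Finset.range (n + 3), clfWeight k * clfWeight (n + 2 - k)
      = 8 * (3 * (n + 1) ^ 2 + 3 * (n + 1) + 1)
          * ∑ k ∈ Finset.range (n + 2), clfWeight k * clfWeight (n + 1 - k)
        - 128 * (n + 1) ^ 3 * ∑ k ∈ Finset.range (n + 1), clfWeight k * clfWeight (n - k) := by
  have h := clfWeight_convolution_partial (n + 1) (n + 1) le_rfl
  simp only [Finset.sum_add_distrib, Finset.sum_sub_distrib, ← Finset.mul_sum] at h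
  rw [Finset.sum_range_succ _ (n + 2), Finset.sum_range_succ _ (n + 1),
    Finset.sum_range_succ (fun k => clfWeight k * clfWeight (n + 1 - k)) (n + 1)]
  simp only [Nat.add_sub_cancel, Nat.sub_self, show n + 2 - (n + 1) = 1 by omega] at h ⊢
  have h1 : clfWeight 1 = 4 := by simp [clfWeight]; norm_num
  rw [clfWeight_zero] at h ⊢
  rw [h1, clfWeight_succ (n + 1)]
  push_cast at h ⊢
  simp only [show n + 1 + 1 = n + 2 by omega] at h
  have h2 : ((n : ℚ) + 1 + 1) ≠ 0 := by positivity
  have h3 : ((n : ℚ) + 2) * (4 * (2 * (n + 1) + 1) ^ 2 / (n + 1 + 1) * clfWeight (n + 1) * 1)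
      = 4 * (2 * (n + 1) + 1) ^ 2 * clfWeight (n + 1) := by
    field_simp
    ring
  rw [sub_self, zero_add, div_one] at h
  linear_combination h + h3

theorem catalanLarcombeFrench_rec (n : ℕ) :
    ((n : ℚ) + 2) ^ 2 * catalanLarcombeFrench (n + 2)
      = 8 * (3 * (n + 1) ^ 2 + 3 * (n + 1) + 1) * catalanLarcombeFrench (n + 1)
        - 128 * (n + 1) ^ 2 * catalanLarcombeFrench n := by
  have h := clfWeight_convolution_rec n
  simp only [← factorial_mul_catalanLarcombeFrench, Nat.factorial_succ] at h
  have h1 : (n.factorial : ℚ) ≠ 0 := by exact_mod_cast n.factorial_ne_zero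
  push_cast at h
  have h2 : ((n : ℚ) + 1) ≠ 0 := by positivity
  apply mul_left_cancel₀ (mul_ne_zero h1 h2)
  linear_combination h

/-- The sum `∑_k C(2k,k)^2 C(k,n-k) (-4)^(n-k)`. -/
def clfAlt (n : ℕ) : ℚ :=
  ∑ k ∈ Finset.range (n + 1),
    ((2 * k).choose k : ℚ) ^ 2 * (k.choose (n - k) : ℚ) * (-4) ^ (n - k)

/-- The certificate for the second sum. Its recurrence is that of $P_n$ after division by $2^n$, so
two initial values settle the identification. -/
theorem clfAlt_partial (n K : ℕ) (hK : K ≤ n) :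
    ∑ k ∈ Finset.range K,
      ((n + 1) ^ 2 * (((2 * k).choose k : ℚ) ^ 2 * (k.choose (n + 1 - k) : ℚ) * (-4) ^ (n + 1 - k))
        - 4 * (3 * n ^ 2 + 3 * n + 1)
          * (((2 * k).choose k : ℚ) ^ 2 * (k.choose (n - k) : ℚ) * (-4) ^ (n - k))
        + 32 * n ^ 2
          * (((2 * k).choose k : ℚ) ^ 2 * (k.choose (n - 1 - k) : ℚ) * (-4) ^ (n - 1 - k)))
      = -(n + 1) * K * ((2 * K).choose K : ℚ) ^ 2 * (K.choose (n + 1 - K) : ℚ)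
          * (-4) ^ (n + 1 - K) := by
  induction K with
  | zero => simp
  | succ k ih =>
    rw [Finset.sum_range_succ, ih (by omega)]
    obtain ⟨j, rfl⟩ : ∃ j, n = k + 1 + j := ⟨n - (k + 1), by omega⟩
    rw [show k + 1 + j + 1 - k = j + 2 by omega, show k + 1 + j - k = j + 1 by omega,
      show k + 1 + j - 1 - k = j by omega, show k + 1 + j + 1 - (k + 1) = j + 1 by omega]
    have r : ∀ i : ℕ, (k.choose (i + 1) : ℚ) = (k.choose i : ℚ) * ((k : ℚ) - i) / (i + 1) := by
      intro i
      rw [eq_div_iff (by positivity)]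
      rcases le_or_gt i k with hi | hi
      · have := Nat.choose_succ_right_eq k i
        rw [← Nat.cast_sub hi]
        exact_mod_cast this
      · rw [Nat.choose_eq_zero_of_lt hi, Nat.choose_eq_zero_of_lt (by omega)]
        simp
    rw [centralBinom_succ_rat, Nat.choose_succ_succ k j]
    push_cast
    rw [r (j + 1), r j]
    push_cast
    rw [show (j : ℚ) + 1 + 1 = j + 2 by ring]
    field_simp
    ring

theorem clfAlt_rec (n : ℕ) :
    ((n : ℚ) + 2) ^ 2 * clfAlt (n + 2)
      = 4 * (3 * (n + 1) ^ 2 + 3 * (n + 1) + 1) * clfAlt (n + 1)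
        - 32 * (n + 1) ^ 2 * clfAlt n := by
  have h := clfAlt_partial (n + 1) (n + 1) le_rfl
  simp only [Finset.sum_add_distrib, Finset.sum_sub_distrib, ← Finset.mul_sum] at h
  unfold clfAlt
  rw [Finset.sum_range_succ _ (n + 2), Finset.sum_range_succ _ (n + 1),
    Finset.sum_range_succ
      (fun k => ((2 * k).choose k : ℚ) ^ 2 * (k.choose (n + 1 - k) : ℚ) * (-4) ^ (n + 1 - k))
      (n + 1)]
  simp only [Nat.add_sub_cancel, Nat.sub_self, show n + 2 - (n + 1) = 1 by omega,
    Nat.choose_one_right, Nat.choose_zero_right,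
    show n + 1 + 1 = n + 2 by omega] at h ⊢
  have h1 := centralBinom_succ_rat (n + 1)
  have h2 : ((n : ℚ) + 2) * ((2 * (n + 2)).choose (n + 2) : ℚ)
      = 2 * (2 * (n + 1) + 1) * ((2 * (n + 1)).choose (n + 1) : ℚ) := by
    rw [h1]
    push_cast
    field_simp
    ring
  push_cast at h ⊢
  linear_combination h + (((n : ℚ) + 2) * ((2 * (n + 2)).choose (n + 2) : ℚ)
      + 2 * (2 * (n + 1) + 1) * ((2 * (n + 1)).choose (n + 1) : ℚ)) * h2

theorem catalanLarcombeFrench_eq (n : ℕ) : catalanLarcombeFrench n = 2 ^ n * clfAlt n := by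
  induction n using Nat.twoStepInduction with
  | zero => simp [catalanLarcombeFrench, clfAlt]
  | one => norm_num [catalanLarcombeFrench, clfAlt, Finset.sum_range_succ, Nat.choose]
  | more n h0 h1 =>
    have hp := catalanLarcombeFrench_rec n
    have ha := clfAlt_rec n
    have h2 : ((n : ℚ) + 2) ^ 2 ≠ 0 := by positivity
    apply mul_left_cancel₀ h2
    rw [hp, h0, h1]
    linear_combination -2 ^ (n + 2) * ha

/-! ### Truncated generating function -/

/-- Rearranged truncated generating function of the numbers `P_n`. -/
theorem sum_catalanLarcombeFrench (N : ℕ) (z : ℚ) :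
    ∑ n ∈ Finset.range N, catalanLarcombeFrench n * z ^ n
      = ∑ k ∈ Finset.range N, ((2 * k).choose k : ℚ) ^ 2 * (2 * z) ^ k
          * ∑ j ∈ Finset.range (N - k), (k.choose j : ℚ) * (-8 * z) ^ j := by
  simp only [Finset.mul_sum]
  rw [Finset.sum_sigma', ← Finset.sum_fiberwise_of_maps_to (g := fun x : (_ : ℕ) × ℕ => x.1 + x.2) (t := Finset.range N)]
  · refine Finset.sum_congr rfl fun n hn => ?_
    rw [catalanLarcombeFrench_eq, clfAlt, Finset.mul_sum, Finset.sum_mul]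
    refine Finset.sum_bij' (fun k _ => ⟨k, n - k⟩) (fun x _ => x.1) ?_ ?_ ?_ ?_ ?_
    · intro k hk
      simp only [Finset.mem_range, Finset.mem_filter, Finset.mem_sigma] at *
      omega
    · intro x hx
      simp only [Finset.mem_range, Finset.mem_filter, Finset.mem_sigma] at *
      omega
    · intro k hk
      rfl
    · rintro ⟨k, j⟩ hx
      simp only [Finset.mem_range, Finset.mem_filter, Finset.mem_sigma] at *
      simp only [Sigma.mk.injEq, heq_eq_eq, true_and]
      omega
    · intro k hk
      simp only [Finset.mem_range] at *
      obtain ⟨j, rfl⟩ : ∃ j, n = k + j := ⟨n - k, by omega⟩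
      simp only [Nat.add_sub_cancel_left]
      rw [show (-8 * z) = 2 * z * (-4) by ring, mul_pow, mul_pow, mul_pow]
      ring
  · rintro ⟨k, j⟩ hx
    simp only [Finset.mem_range, Finset.mem_sigma] at *
    omega

/-! ### Congruences between $p$-integral rationals -/

/-- The subring of rationals whose reduced denominator is not divisible by the prime `p`. -/
def pIntegral (p : ℕ) [hp : Fact p.Prime] : Subring ℚ where
  carrier := {x | ¬ p ∣ x.den}
  mul_mem' := by
    intro a b ha hb h
    exact (hp.out.dvd_mul.mp (h.trans (Rat.mul_den_dvd a b))).elim ha hb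
  one_mem' := by simpa using hp.out.one_lt.ne'
  add_mem' := by
    intro a b ha hb h
    exact (hp.out.dvd_mul.mp (h.trans (Rat.add_den_dvd a b))).elim ha hb
  zero_mem' := by simpa using hp.out.one_lt.ne'
  neg_mem' := by
    intro a ha
    simpa using ha

/-- Congruence modulo `p ^ r` in the ring of `p`-integral rationals. -/
def LocModEq (p : ℕ) [Fact p.Prime] (r : ℕ) (x y : ℚ) : Prop :=
  ∃ c ∈ pIntegral p, x - y = (p : ℚ) ^ r * c

section LocModEq

variable {p : ℕ} [hp : Fact p.Prime]

theorem mem_pIntegral {x : ℚ} : x ∈ pIntegral p ↔ ¬ p ∣ x.den := Iff.rfl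

theorem inv_int_mem_pIntegral {z : ℤ} (hz : ¬ (p : ℤ) ∣ z) : (z : ℚ)⁻¹ ∈ pIntegral p := by
  rw [mem_pIntegral, Rat.inv_intCast_den]
  split_ifs with h
  · simpa using hp.out.one_lt.ne'
  · rwa [← Int.natCast_dvd]

theorem inv_natCast_mem_pIntegral {n : ℕ} (hn : ¬ p ∣ n) : (n : ℚ)⁻¹ ∈ pIntegral p := by
  have := inv_int_mem_pIntegral (p := p) (z := n) (by exact_mod_cast hn)
  simpa using this

theorem inv_natCast_mem_pIntegral_of_lt {n : ℕ} (h0 : 0 < n) (hn : n < p) :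
    (n : ℚ)⁻¹ ∈ pIntegral p :=
  inv_natCast_mem_pIntegral (Nat.not_dvd_of_pos_of_lt h0 hn)

theorem int_div_mem_pIntegral (a : ℤ) {z : ℤ} (hz : ¬ (p : ℤ) ∣ z) :
    (a / z : ℚ) ∈ pIntegral p := by
  rw [div_eq_mul_inv]
  exact mul_mem (intCast_mem _ _) (inv_int_mem_pIntegral hz)

namespace LocModEq

variable {r : ℕ} {x y z w : ℚ}

theorem refl (x : ℚ) : LocModEq p r x x := ⟨0, zero_mem _, by simp⟩

theorem of_eq (h : x = y) : LocModEq p r x y := h ▸ refl x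

theorem trans (h : LocModEq p r x y) (h' : LocModEq p r y z) : LocModEq p r x z := by
  obtain ⟨c, hc, h⟩ := h
  obtain ⟨d, hd, h'⟩ := h'
  exact ⟨c + d, add_mem hc hd, by linear_combination h + h'⟩

theorem add (h : LocModEq p r x y) (h' : LocModEq p r z w) : LocModEq p r (x + z) (y + w) := by
  obtain ⟨c, hc, h⟩ := h
  obtain ⟨d, hd, h'⟩ := h'
  exact ⟨c + d, add_mem hc hd, by linear_combination h + h'⟩

theorem neg (h : LocModEq p r x y) : LocModEq p r (-x) (-y) := by
  obtain ⟨c, hc, h⟩ := h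
  exact ⟨-c, neg_mem hc, by linear_combination -h⟩

theorem sub (h : LocModEq p r x y) (h' : LocModEq p r z w) : LocModEq p r (x - z) (y - w) := by
  simpa [sub_eq_add_neg] using h.add h'.neg

theorem mul_left (hz : z ∈ pIntegral p) (h : LocModEq p r x y) : LocModEq p r (z * x) (z * y) := by
  obtain ⟨c, hc, h⟩ := h
  exact ⟨z * c, mul_mem hz hc, by linear_combination z * h⟩

theorem mul (h : LocModEq p r x y) (h' : LocModEq p r z w) (hx : x ∈ pIntegral p)
    (hw : w ∈ pIntegral p) : LocModEq p r (x * z) (y * w) := by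
  refine (h'.mul_left hx).trans ?_
  rw [mul_comm x, mul_comm y]
  exact h.mul_left hw

theorem pow_mul_left {s : ℕ} (h : LocModEq p r x y) :
    LocModEq p (s + r) ((p : ℚ) ^ s * x) ((p : ℚ) ^ s * y) := by
  obtain ⟨c, hc, h⟩ := h
  exact ⟨c, hc, by rw [pow_add]; linear_combination (p : ℚ) ^ s * h⟩

theorem sum {ι : Type*} {s : Finset ι} {f g : ι → ℚ} (h : ∀ i ∈ s, LocModEq p r (f i) (g i)) :
    LocModEq p r (∑ i ∈ s, f i) (∑ i ∈ s, g i) := by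
  classical
  induction s using Finset.induction_on with
  | empty => simpa using refl 0
  | insert a s ha ih =>
    rw [Finset.sum_insert ha, Finset.sum_insert ha]
    exact (h a (Finset.mem_insert_self a s)).add
      (ih fun i hi => h i (Finset.mem_insert_of_mem hi))

theorem mem (h : LocModEq p r x y) (hy : y ∈ pIntegral p) : x ∈ pIntegral p := by
  obtain ⟨c, hc, h⟩ := h
  rw [show x = y + (p : ℚ) ^ r * c by linear_combination h]
  exact add_mem hy (mul_mem (pow_mem (natCast_mem _ _) _) hc)

theorem int_div {a b c d : ℤ} (hb : ¬ (p : ℤ) ∣ b) (hd : ¬ (p : ℤ) ∣ d)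
    (h : (p : ℤ) ∣ a * d - c * b) : LocModEq p 1 (a / b : ℚ) (c / d : ℚ) := by
  obtain ⟨e, he⟩ := h
  have hb' : (b : ℚ) ≠ 0 := by rintro h; apply hb; simp_all
  have hd' : (d : ℚ) ≠ 0 := by rintro h; apply hd; simp_all
  refine ⟨e * ((b : ℚ)⁻¹ * (d : ℚ)⁻¹), mul_mem (intCast_mem _ _)
    (mul_mem (inv_int_mem_pIntegral hb) (inv_int_mem_pIntegral hd)), ?_⟩
  have he' : (a * d - c * b : ℚ) = p * e := by exact_mod_cast he
  field_simp
  linear_combination he'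

theorem of_int_dvd {a b : ℤ} (h : (p : ℤ) ∣ a - b) : LocModEq p 1 (a : ℚ) (b : ℚ) := by
  obtain ⟨e, he⟩ := h
  refine ⟨e, intCast_mem _ _, ?_⟩
  rw [pow_one]
  exact_mod_cast he

theorem ratModEq (h : LocModEq p (r + 1) x y) : RatModEq (p ^ (r + 1)) x y := by
  obtain ⟨c, hc, h⟩ := h
  refine ⟨c, ?_, by push_cast; exact h⟩
  exact Nat.Coprime.pow_right _ ((Nat.Prime.coprime_iff_not_dvd hp.out).mpr hc).symm

end LocModEq

/-- By Fermat, $1/x^2\equiv x^{p-3}$, and a power sum over $\mathbb F_p$ of exponent below $p-1$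
vanishes. -/
theorem sum_inv_sq_locModEq_zero (h5 : 5 ≤ p) :
    LocModEq p 1 (∑ j ∈ Finset.range (p - 1), (1 / ((j : ℚ) + 1) ^ 2)) 0 := by
  have hterm : ∀ j ∈ Finset.range (p - 1),
      LocModEq p 1 (1 / ((j : ℚ) + 1) ^ 2) (((j : ℚ) + 1) ^ (p - 3)) := by
    intro j hj
    have hj' := Finset.mem_range.mp hj
    have hnd : ¬ (p : ℤ) ∣ (j + 1 : ℤ) := by
      have := Nat.not_dvd_of_pos_of_lt (Nat.succ_pos j) (show j + 1 < p by omega)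
      exact_mod_cast this
    have h := LocModEq.int_div (p := p) (a := 1) (b := (j + 1 : ℤ) ^ 2) (c := (j + 1 : ℤ) ^ (p - 3))
      (d := 1) (fun h => hnd (Int.Prime.dvd_pow' hp.out h))
      (by exact_mod_cast hp.out.not_dvd_one) ?_
    · push_cast at h
      simpa using h
    · rw [one_mul, ← pow_add, show p - 3 + 2 = p - 1 by omega, ← Int.modEq_iff_dvd]
      exact Int.ModEq.pow_card_sub_one_eq_one hp.out
        ((Int.isCoprime_iff_gcd_eq_one.mpr (by
          rw [Int.gcd_comm]
          exact (Int.isCoprime_iff_gcd_eq_one.mp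
            ((Nat.prime_iff_prime_int.mp hp.out).coprime_iff_not_dvd.mpr hnd)))))
  refine (LocModEq.sum hterm).trans ?_
  have hz : ((∑ j ∈ Finset.range (p - 1), ((j : ℤ) + 1) ^ (p - 3) : ℤ) : ZMod p) = 0 := by
    have h := FiniteField.sum_pow_lt_card_sub_one (ZMod p) (p - 3) (by rw [ZMod.card]; omega)
    push_cast
    rw [← h]
    symm
    have e : ∑ x : ZMod p, x ^ (p - 3) = ∑ j ∈ Finset.range p, (j : ZMod p) ^ (p - 3) := by
      refine Finset.sum_bij' (fun x _ => x.val) (fun j _ => (j : ZMod p)) ?_ ?_ ?_ ?_ ?_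
      · intro x _; exact Finset.mem_range.mpr (ZMod.val_lt x)
      · intro j _; exact Finset.mem_univ _
      · intro x _; simp
      · intro j hj; exact ZMod.val_cast_of_lt (Finset.mem_range.mp hj)
      · intro x _; simp
    rw [e]
    obtain ⟨q, rfl⟩ : ∃ q, p = q + 1 := ⟨p - 1, by omega⟩
    -- The term $0^{p-3}$ is zero because $p>3$.
    rw [Finset.sum_range_succ']
    simp [show q - 2 ≠ 0 by omega]
  rw [ZMod.intCast_zmod_eq_zero_iff_dvd] at hz
  have := LocModEq.of_int_dvd (p := p) (a := ∑ j ∈ Finset.range (p - 1), ((j : ℤ) + 1) ^ (p - 3))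
    (b := 0) (by simpa using hz)
  push_cast at this
  exact this

end LocModEq

/-! ### Wolstenholme-type harmonic sums -/

section Harmonic

theorem not_int_dvd_of_pos_of_lt {p : ℕ} {z : ℤ} (h0 : 0 < z) (h1 : z < p) : ¬ (p : ℤ) ∣ z :=
  fun h => absurd (Int.le_of_dvd h0 h) (by omega)

variable {p : ℕ} [hp : Fact p.Prime]

/-- Since $j^2\equiv(p-j)^2$, the full sum is twice the half sum. -/
theorem half_sum_inv_sq_locModEq_zero {m : ℕ} (hm : p = 2 * m + 1) (h5 : 5 ≤ p) :
    LocModEq p 1 (∑ j ∈ Finset.range m, (1 / ((j : ℚ) + 1) ^ 2)) 0 := by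
  have h := sum_inv_sq_locModEq_zero h5
  rw [show p - 1 = m + m by omega, Finset.sum_range_add,
    ← Finset.sum_range_reflect (fun x => (1 / (((m + x : ℕ) : ℚ) + 1) ^ 2))] at h
  have h2 : LocModEq p 1 (∑ j ∈ Finset.range m, (1 / ((j : ℚ) + 1) ^ 2))
      (∑ j ∈ Finset.range m, (1 / (((m + (m - 1 - j) : ℕ) : ℚ) + 1) ^ 2)) := by
    refine LocModEq.sum fun j hj => ?_
    have hj' := Finset.mem_range.mp hj
    have e : ((m + (m - 1 - j) : ℕ) : ℚ) + 1 = ((p - (j + 1) : ℤ) : ℚ) := by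
      have : m + (m - 1 - j) + 1 + (j + 1) = p := by omega
      have : (((m + (m - 1 - j) : ℕ) : ℚ) + 1 + (j + 1)) = p := by exact_mod_cast this
      push_cast at this ⊢
      linarith
    rw [e]
    have h1 := LocModEq.int_div (p := p) (a := 1) (b := (j + 1 : ℤ) ^ 2) (c := 1)
      (d := (p - (j + 1) : ℤ) ^ 2)
      (fun h => not_int_dvd_of_pos_of_lt (by omega) (by omega) (Int.Prime.dvd_pow' hp.out h))
      (fun h => not_int_dvd_of_pos_of_lt (by omega) (by omega) (Int.Prime.dvd_pow' hp.out h))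
      ⟨p - 2 * (j + 1), by ring⟩
    push_cast at h1 ⊢
    exact h1
  have h3 := (((LocModEq.refl _).add h2).trans h).mul_left
    (inv_natCast_mem_pIntegral_of_lt (p := p) (n := 2) (by omega) (by omega))
  convert h3 using 1 <;> push_cast <;> ring

/-- Pairing $1/j+1/(p-j)=p/(j(p-j))$ yields one factor $p$; the cofactor is a multiple of $\sum
1/j^2$ modulo $p$, which yields the other. -/
theorem sum_inv_locModEq_zero {m : ℕ} (hm : p = 2 * m + 1) (h5 : 5 ≤ p) :
    LocModEq p 2 (∑ j ∈ Finset.range (p - 1), (1 / ((j : ℚ) + 1))) 0 := by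
  have hsum : ∑ j ∈ Finset.range (p - 1), (1 / ((j : ℚ) + 1))
      = (p : ℚ) ^ 1 * ∑ j ∈ Finset.range (p - 1), ((1 : ℤ) / ((2 * (j + 1) * (p - (j + 1)) : ℤ) : ℚ)) := by
    have e : ∑ j ∈ Finset.range (p - 1), (1 / ((j : ℚ) + 1))
        = ∑ j ∈ Finset.range (p - 1), (1 / ((p : ℚ) - (j + 1))) := by
      rw [← Finset.sum_range_reflect]
      refine Finset.sum_congr rfl fun j hj => ?_
      have hj' := Finset.mem_range.mp hj
      have : p - 1 - 1 - j + 1 + (j + 1) = p := by omega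
      have : (((p - 1 - 1 - j : ℕ) : ℚ) + 1 + (j + 1)) = p := by exact_mod_cast this
      rw [← this]
      ring
    have e2 : ∑ j ∈ Finset.range (p - 1), (1 / ((j : ℚ) + 1)) = 1 / 2 *
        ∑ j ∈ Finset.range (p - 1), (1 / ((j : ℚ) + 1) + 1 / ((p : ℚ) - (j + 1))) := by
      rw [Finset.sum_add_distrib, ← e]
      ring
    rw [e2, Finset.mul_sum, Finset.mul_sum]
    refine Finset.sum_congr rfl fun j hj => ?_
    have hj' := Finset.mem_range.mp hj
    have h1 : (p : ℚ) - (j + 1) ≠ 0 := by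
      have : (j + 1 : ℚ) < p := by exact_mod_cast (by omega : j + 1 < p)
      linarith
    push_cast
    field_simp
    ring
  rw [hsum]
  have hs : LocModEq p 1
      (∑ j ∈ Finset.range (p - 1), ((1 : ℤ) / ((2 * (j + 1) * (p - (j + 1)) : ℤ) : ℚ)))
      (∑ j ∈ Finset.range (p - 1), (((-1 : ℤ) : ℚ) / ((2 * (j + 1) ^ 2 : ℤ) : ℚ))) := by
    refine LocModEq.sum fun j hj => ?_
    have hj' := Finset.mem_range.mp hj
    have n1 : ¬ (p : ℤ) ∣ (j + 1 : ℤ) := not_int_dvd_of_pos_of_lt (by omega) (by omega)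
    have n2 : ¬ (p : ℤ) ∣ (p - (j + 1) : ℤ) := not_int_dvd_of_pos_of_lt (by omega) (by omega)
    have n3 : ¬ (p : ℤ) ∣ 2 := not_int_dvd_of_pos_of_lt (by omega) (by omega)
    have pp := Nat.prime_iff_prime_int.mp hp.out
    refine LocModEq.int_div ?_ ?_ ⟨2 * (j + 1), by ring⟩
    · intro h
      rcases pp.dvd_mul.mp h with h | h
      · exact (pp.dvd_mul.mp h).elim n3 n1
      · exact n2 h
    · intro h
      exact (pp.dvd_mul.mp h).elim n3 fun h => n1 (Int.Prime.dvd_pow' hp.out h)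
  have h0 := (sum_inv_sq_locModEq_zero h5).mul_left
    (neg_mem (inv_natCast_mem_pIntegral_of_lt (p := p) (n := 2) (by omega) (by omega)))
  have h1 := hs.trans ((LocModEq.of_eq (r := 1) ?_).trans h0)
  · simpa using h1.pow_mul_left (s := 1)
  · rw [Finset.mul_sum]
    refine Finset.sum_congr rfl fun j _ => ?_
    push_cast
    field_simp

end Harmonic

/-! ### Euler numbers and alternating sums of inverse squares -/

section Euler

theorem eulerNumber_succ (n : ℕ) :
    eulerNumber (n + 1) = -∑ k ∈ Finset.Icc 1 ((n + 1) / 2),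
      ((n + 1).choose (2 * k) : ℤ) * eulerNumber (n + 1 - 2 * k) := by
  rw [eulerNumber, Finset.sum_attach (Finset.Icc 1 ((n + 1) / 2))
    (fun k => ((n + 1).choose (2 * k) : ℤ) * eulerNumber (n + 1 - 2 * k))]

theorem eulerNumber_odd {n : ℕ} (hn : Odd n) : eulerNumber n = 0 := by
  induction n using Nat.strong_induction_on with
  | _ n ih =>
    obtain ⟨m, rfl⟩ := hn
    rw [eulerNumber_succ, Finset.sum_eq_zero, neg_zero]
    intro k hk
    have hk' := Finset.mem_Icc.mp hk
    rw [ih _ (by omega) ⟨m - k, by omega⟩, mul_zero]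

/-- The defining recursion, with the factor $1+(-1)^s$ selecting even indices so that it fits
binomial expansions of $(x\pm1)^i$. -/
theorem sum_even_choose_mul_eulerNumber (n : ℕ) :
    ∑ s ∈ Finset.range (n + 1), (n.choose s : ℤ) * eulerNumber (n - s) * (1 + (-1) ^ s)
      = if n = 0 then 2 else 0 := by
  rcases n with _ | n
  · simp [eulerNumber]
  · rw [if_neg (Nat.succ_ne_zero n)]
    have h : ∑ k ∈ Finset.range ((n + 1) / 2 + 1),
        ((n + 1).choose (2 * k) : ℤ) * eulerNumber (n + 1 - 2 * k) = 0 := by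
      have h := eulerNumber_succ n
      rw [Finset.range_eq_Ico, Finset.sum_eq_sum_Ico_succ_bot (by omega), Finset.Ico_add_one_right_eq_Icc]
      simp only [mul_zero, Nat.choose_zero_right, Nat.sub_zero, zero_add]
      rw [h]
      simp
    rw [← Finset.sum_filter_add_sum_filter_not _ (fun s => Even s)]
    have h1 : ∑ s ∈ Finset.range (n + 1 + 1) with ¬ Even s,
        ((n + 1).choose s : ℤ) * eulerNumber (n + 1 - s) * (1 + (-1) ^ s) = 0 := by
      refine Finset.sum_eq_zero fun s hs => ?_
      rw [(Nat.not_even_iff_odd.mp (Finset.mem_filter.mp hs).2).neg_one_pow]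
      simp
    rw [h1, add_zero]
    have h2 : ∑ s ∈ Finset.range (n + 1 + 1) with Even s,
        ((n + 1).choose s : ℤ) * eulerNumber (n + 1 - s) * (1 + (-1) ^ s)
        = 2 * ∑ k ∈ Finset.range ((n + 1) / 2 + 1),
          ((n + 1).choose (2 * k) : ℤ) * eulerNumber (n + 1 - 2 * k) := by
      rw [Finset.mul_sum]
      refine Finset.sum_bij' (fun s _ => s / 2) (fun k _ => 2 * k) ?_ ?_ ?_ ?_ ?_
      · intro s hs
        have := Finset.mem_range.mp (Finset.mem_filter.mp hs).1
        exact Finset.mem_range.mpr (by omega)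
      · intro k hk
        have := Finset.mem_range.mp hk
        exact Finset.mem_filter.mpr ⟨Finset.mem_range.mpr (by omega), even_two_mul k⟩
      · intro s hs
        exact Nat.two_mul_div_two_of_even (Finset.mem_filter.mp hs).2
      · intro k _
        simp
      · intro s hs
        rw [Nat.two_mul_div_two_of_even (Finset.mem_filter.mp hs).2,
          (Finset.mem_filter.mp hs).2.neg_one_pow]
        ring
    rw [h2, h, mul_zero]

/-- The integral Euler polynomial `2^n E_n((x+1)/2)`. -/
def eulerPoly (n : ℕ) (x : ℤ) : ℤ :=
  ∑ i ∈ Finset.range (n + 1), (n.choose i : ℤ) * eulerNumber (n - i) * x ^ i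

theorem eulerPoly_add_one_add_sub_one (n : ℕ) (x : ℤ) :
    eulerPoly n (x + 1) + eulerPoly n (x - 1) = 2 * x ^ n := by
  have hpow : ∀ i ∈ Finset.range (n + 1), (x + 1) ^ i + (x - 1) ^ i
      = ∑ t ∈ Finset.range (n + 1), x ^ t * (i.choose t : ℤ) * (1 + (-1) ^ (i - t)) := by
    intro i hi
    have hi' := Finset.mem_range.mp hi
    rw [sub_eq_add_neg, add_pow, add_pow, ← Finset.sum_add_distrib]
    -- For $t>i$ the exponent `i - t` truncates to 0, harmlessly, since the binomial coefficient
    -- vanishes.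
    refine Finset.sum_subset_zero_on_sdiff (Finset.range_mono (by omega)) ?_ ?_
    · intro t ht
      simp only [Finset.mem_sdiff, Finset.mem_range] at ht
      rw [Nat.choose_eq_zero_of_lt (by omega)]
      simp
    · intro t _
      rw [one_pow]
      ring
  unfold eulerPoly
  rw [← Finset.sum_add_distrib]
  have h1 : ∑ i ∈ Finset.range (n + 1), ((n.choose i : ℤ) * eulerNumber (n - i) * (x + 1) ^ i
        + (n.choose i : ℤ) * eulerNumber (n - i) * (x - 1) ^ i)
      = ∑ t ∈ Finset.range (n + 1), x ^ t * ((n.choose t : ℤ) * if n - t = 0 then 2 else 0) := by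
    rw [Finset.sum_congr rfl fun i hi => by rw [← mul_add, hpow i hi, Finset.mul_sum]]
    rw [Finset.sum_comm]
    refine Finset.sum_congr rfl fun t ht => ?_
    have ht' := Finset.mem_range.mp ht
    rw [← sum_even_choose_mul_eulerNumber, show n + 1 = t + (n - t + 1) by omega,
      Finset.sum_range_add, Finset.sum_eq_zero, zero_add, Finset.mul_sum, Finset.mul_sum]
    · refine Finset.sum_congr rfl fun s hs => ?_
      have hs' := Finset.mem_range.mp hs
      have hc := Nat.choose_mul (n := n) (k := t + s) (s := t) (by omega)
      rw [Nat.add_sub_cancel_left] at hc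
      have hc' : (n.choose (t + s) : ℤ) * ((t + s).choose t : ℤ)
          = (n.choose t : ℤ) * ((n - t).choose s : ℤ) := by exact_mod_cast hc
      rw [Nat.add_sub_cancel_left, show n - (t + s) = n - t - s by omega]
      linear_combination (eulerNumber (n - t - s) * x ^ t * (1 + (-1) ^ s)) * hc'
    · intro i hi
      rw [Nat.choose_eq_zero_of_lt (Finset.mem_range.mp hi)]
      simp
  rw [h1, Finset.sum_range_succ, Finset.sum_eq_zero]
  · simp [mul_comm]
  · intro t ht
    have := Finset.mem_range.mp ht
    rw [if_neg (by omega)]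
    simp

theorem eulerPoly_one {n : ℕ} (hn : Even n) (h0 : n ≠ 0) : eulerPoly n 1 = 0 := by
  have h := sum_even_choose_mul_eulerNumber n
  rw [if_neg h0] at h
  have h2 : 2 * eulerPoly n 1 = 0 := by
    rw [← h, eulerPoly, Finset.mul_sum]
    refine Finset.sum_congr rfl fun s hs => ?_
    have hs' := Finset.mem_range.mp hs
    rcases Nat.even_or_odd s with he | ho
    · rw [he.neg_one_pow]
      ring
    · rw [eulerNumber_odd (Nat.Even.sub_odd (by omega) hn ho)]
      ring
  omega

/-- The functional equation at $x=2,4,\dots,2m$, with alternating signs, telescopes. -/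
theorem sum_alternating_pow (n m : ℕ) (h1 : eulerPoly n 1 = 0) :
    ∑ j ∈ Finset.range m, (-1) ^ (j + 1) * (2 * (2 * ((j : ℤ) + 1)) ^ n)
      = (-1) ^ m * eulerPoly n (2 * m + 1) := by
  induction m with
  | zero => simpa using h1.symm
  | succ m ih =>
    rw [Finset.sum_range_succ, ih, ← eulerPoly_add_one_add_sub_one]
    push_cast
    ring_nf

variable {p : ℕ} [hp : Fact p.Prime]

/-- Fermat turns inverse squares into powers of exponent $p-3$. The telescoped sum ends at argument
$2m+1=p$, where modulo $p$ only the constant coefficient $E_{p-3}$ remains. -/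
theorem sum_alternating_inv_sq_locModEq {m : ℕ} (hm : p = 2 * m + 1) (h5 : 5 ≤ p) :
    LocModEq p 1 (∑ j ∈ Finset.range m, ((-1) ^ (j + 1) / ((j : ℚ) + 1) ^ 2))
      (2 * (-1) ^ m * (eulerNumber (p - 3) : ℚ)) := by
  have hn : Even (p - 3) := ⟨m - 1, by omega⟩
  have h := sum_alternating_pow (p - 3) m (eulerPoly_one hn (by omega))
  have hE : (p : ℤ) ∣ eulerPoly (p - 3) (2 * m + 1) - eulerNumber (p - 3) := by
    rw [show (2 * m + 1 : ℤ) = p by rw [hm]; push_cast; ring, eulerPoly, Finset.sum_range_succ']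
    simp only [Nat.choose_zero_right, Nat.sub_zero, pow_zero, Nat.cast_one, one_mul, mul_one,
      add_sub_cancel_right]
    refine Finset.dvd_sum fun i _ => ?_
    rw [pow_succ]
    exact (dvd_mul_left _ _).mul_left _
  have key : LocModEq p 1 (2⁻¹ * ∑ j ∈ Finset.range m, ((-1) ^ (j + 1) / ((j : ℚ) + 1) ^ 2))
      ((((-1) ^ m * eulerPoly (p - 3) (2 * m + 1) : ℤ) : ℚ)) := by
    rw [← h, Finset.mul_sum]
    push_cast
    refine LocModEq.sum fun j hj => ?_
    have hj' := Finset.mem_range.mp hj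
    have n1 : ¬ (p : ℤ) ∣ 2 * (2 * (j + 1)) ^ 2 := by
      have pp := Nat.prime_iff_prime_int.mp hp.out
      intro h
      have n3 : ¬ (p : ℤ) ∣ 2 := not_int_dvd_of_pos_of_lt (by omega) (by omega)
      refine (pp.dvd_mul.mp h).elim n3 fun h => ?_
      exact not_int_dvd_of_pos_of_lt (p := p) (by omega) (by omega) (pp.dvd_of_dvd_pow h)
    have hf : (p : ℤ) ∣ (2 * (j + 1)) ^ (p - 1) - 1 := by
      have nd : ¬ (p : ℤ) ∣ (2 * (j + 1)) := not_int_dvd_of_pos_of_lt (by omega) (by omega)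
      exact (Int.ModEq.pow_card_sub_one_eq_one hp.out
        (((Nat.prime_iff_prime_int.mp hp.out).coprime_iff_not_dvd.mpr nd).symm)).symm.dvd
    have h1 := LocModEq.int_div (p := p) (a := 4 * (-1) ^ (j + 1))
      (b := 2 * (2 * (j + 1)) ^ 2) (c := (-1) ^ (j + 1) * (2 * (2 * ((j : ℤ) + 1)) ^ (p - 3)))
      (d := 1) n1 (by exact_mod_cast hp.out.not_dvd_one) (by
        rw [show (4 * (-1) ^ (j + 1) * 1 - (-1) ^ (j + 1) * (2 * (2 * ((j : ℤ) + 1)) ^ (p - 3))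
          * (2 * (2 * (j + 1)) ^ 2)) = -4 * (-1) ^ (j + 1) * ((2 * ((j : ℤ) + 1)) ^ (p - 1) - 1) by
            rw [show p - 1 = p - 3 + 2 by omega, pow_add]; ring]
        exact hf.mul_left _)
    push_cast at h1
    convert h1 using 1
    · field_simp
      norm_num
    · rw [div_one]
  have h2 := (key.trans (LocModEq.of_int_dvd (b := (-1) ^ m * eulerNumber (p - 3)) (by
    rw [← mul_sub]; exact hE.mul_left _))).mul_left (natCast_mem (pIntegral p) 2)
  convert h2 using 1
  · push_cast
    ring
  · push_cast
    ring

end Euler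

/-! ### Reciprocal binomial sums and the congruence at $1/8$ -/

theorem sum_neg_one_pow_div_choose (n : ℕ) :
    ∑ k ∈ Finset.range (n + 1), (-1 : ℚ) ^ k / (n.choose k : ℚ)
      = (1 + (-1) ^ n) * (n + 1) / (n + 2) := by
  have hstep : ∀ k ∈ Finset.range (n + 1), (-1 : ℚ) ^ k / (n.choose k : ℚ)
      = (n + 1) / (n + 2) * ((-1 : ℚ) ^ k / ((n + 1).choose k : ℚ)
        - (-1 : ℚ) ^ (k + 1) / ((n + 1).choose (k + 1) : ℚ)) := by
    intro k hk
    have hk' := Finset.mem_range.mp hk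
    obtain ⟨l, rfl⟩ : ∃ l, n = k + l := ⟨n - k, by omega⟩
    have h1 : ((k + l + 1).choose k : ℚ) * (l + 1) = (k + l + 1) * ((k + l).choose k : ℚ) := by
      have := Nat.choose_mul_succ_eq (k + l) k
      rw [show k + l + 1 - k = l + 1 by omega] at this
      have : ((k + l).choose k : ℚ) * (k + l + 1) = ((k + l + 1).choose k : ℚ) * (l + 1) := by
        exact_mod_cast this
      linarith
    have h2 : ((k + l + 1).choose (k + 1) : ℚ) * (k + 1)
        = (k + l + 1) * ((k + l).choose k : ℚ) := by
      have := Nat.add_one_mul_choose_eq (k + l) k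
      have : ((k + l + 1 : ℚ)) * ((k + l).choose k : ℚ)
          = ((k + l + 1).choose (k + 1) : ℚ) * (k + 1) := by exact_mod_cast this
      linarith
    have p0 : ((k + l).choose k : ℚ) ≠ 0 := by
      exact_mod_cast (Nat.choose_pos (by omega)).ne'
    have e1 : ((k + l + 1).choose k : ℚ) = (k + l + 1) * ((k + l).choose k : ℚ) / (l + 1) := by
      field_simp
      linarith
    have e2 : ((k + l + 1).choose (k + 1) : ℚ)
        = (k + l + 1) * ((k + l).choose k : ℚ) / (k + 1) := by
      field_simp
      linarith
    rw [e1, e2]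
    push_cast
    field_simp
    ring
  rw [Finset.sum_congr rfl hstep, ← Finset.mul_sum, Finset.sum_range_sub']
  simp
  ring

/-- Raising `m` by one changes $1/\binom{m}{i+1}$ by a multiple of $(i+1)^2/\binom{m-1}{i}$. The
square cancels, and the increment is the alternating reciprocal sum just evaluated. -/
theorem sum_neg_one_pow_div_sq_mul_choose (m : ℕ) :
    ∑ i ∈ Finset.range m, (-1 : ℚ) ^ (i + 1) / ((i + 1) ^ 2 * (m.choose (i + 1) : ℚ))
      = ∑ i ∈ Finset.range m, (1 + 2 * (-1) ^ (i + 1)) / ((i : ℚ) + 1) ^ 2 := by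
  induction m with
  | zero => simp
  | succ m ih =>
    rw [Finset.sum_range_succ, Finset.sum_range_succ, ← ih]
    rcases m with _ | n
    · simp
      norm_num
    have hstep : ∀ i ∈ Finset.range (n + 1),
        (-1 : ℚ) ^ (i + 1) / ((i + 1) ^ 2 * ((n + 1 + 1).choose (i + 1) : ℚ))
        = (-1 : ℚ) ^ (i + 1) / ((i + 1) ^ 2 * ((n + 1).choose (i + 1) : ℚ))
          + 1 / ((n + 1) * (n + 2)) * ((-1) ^ i / (n.choose i : ℚ)) := by
      intro i hi
      have hi' := Finset.mem_range.mp hi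
      obtain ⟨l, rfl⟩ : ∃ l, n = i + l := ⟨n - i, by omega⟩
      have p0 : ((i + l).choose i : ℚ) ≠ 0 := by
        exact_mod_cast (Nat.choose_pos (by omega)).ne'
      have e1 : ((i + l + 1).choose (i + 1) : ℚ)
          = (i + l + 1) * ((i + l).choose i : ℚ) / (i + 1) := by
        have := Nat.add_one_mul_choose_eq (i + l) i
        have : ((i + l + 1 : ℚ)) * ((i + l).choose i : ℚ)
            = ((i + l + 1).choose (i + 1) : ℚ) * (i + 1) := by exact_mod_cast this
        field_simp
        linarith
      have e2 : ((i + l + 1 + 1).choose (i + 1) : ℚ)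
          = (i + l + 2) * ((i + l + 1).choose (i + 1) : ℚ) / (l + 1) := by
        have := Nat.choose_mul_succ_eq (i + l + 1) (i + 1)
        rw [show i + l + 1 + 1 - (i + 1) = l + 1 by omega] at this
        have : ((i + l + 1).choose (i + 1) : ℚ) * (i + l + 1 + 1)
            = ((i + l + 1 + 1).choose (i + 1) : ℚ) * (l + 1) := by exact_mod_cast this
        field_simp
        linarith
      rw [e2, e1]
      push_cast
      field_simp
      ring
    rw [Finset.sum_congr rfl hstep, Finset.sum_add_distrib, ← Finset.mul_sum,
      sum_neg_one_pow_div_choose, Nat.choose_self]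
    push_cast
    rw [show (n : ℚ) + 1 + 1 = n + 2 by ring]
    field_simp
    ring

theorem sum_neg_one_pow_mul_choose_succ (k J : ℕ) :
    ∑ j ∈ Finset.range (J + 1), ((k + 1).choose j : ℚ) * (-1) ^ j = (-1) ^ J * (k.choose J : ℚ) := by
  induction J with
  | zero => simp
  | succ J ih =>
    rw [Finset.sum_range_succ, ih, Nat.choose_succ_succ]
    push_cast
    ring

/-- Summand number `i` (counted from the top) of the rearranged sum of `P_n / 8^n`. -/
def clfTail (m i : ℕ) : ℚ :=
  ((2 * (2 * m - i)).choose (2 * m - i) : ℚ) ^ 2 * (1 / 4) ^ (2 * m - i)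
    * ((-1) ^ i * ((2 * m - i - 1).choose i : ℚ))

theorem sum_catalanLarcombeFrench_div_eight (m : ℕ) (hm : 0 < m) :
    ∑ k ∈ Finset.range (2 * m + 1), catalanLarcombeFrench k / (8 : ℚ) ^ k
      = 1 + ∑ i ∈ Finset.range m, clfTail m i := by
  have h0 : ∑ k ∈ Finset.range (2 * m + 1), catalanLarcombeFrench k / (8 : ℚ) ^ k
      = ∑ k ∈ Finset.range (2 * m + 1), catalanLarcombeFrench k * (1 / 8) ^ k :=
    Finset.sum_congr rfl fun k _ => by rw [div_pow, one_pow, mul_one_div]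
  rw [h0, sum_catalanLarcombeFrench, Finset.sum_range_succ', add_comm]
  congr 1
  · rw [Nat.sub_zero, Finset.sum_range_succ', Finset.sum_eq_zero]
    · simp
    · intro i _
      simp
  · rw [← Finset.sum_range_reflect]
    have h1 : ∀ i ∈ Finset.range (2 * m), clfTail m i
        = ((2 * (2 * m - 1 - i + 1)).choose (2 * m - 1 - i + 1) : ℚ) ^ 2
          * (2 * (1 / 8)) ^ (2 * m - 1 - i + 1)
          * ∑ j ∈ Finset.range (2 * m + 1 - (2 * m - 1 - i + 1)),
            ((2 * m - 1 - i + 1).choose j : ℚ) * (-8 * (1 / 8)) ^ j := by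
      intro i hi
      have hi' := Finset.mem_range.mp hi
      rw [show 2 * m + 1 - (2 * m - 1 - i + 1) = i + 1 by omega,
        show (-8 * (1 / 8) : ℚ) = -1 by norm_num, sum_neg_one_pow_mul_choose_succ, clfTail,
        show 2 * m - 1 - i + 1 = 2 * m - i by omega, show 2 * m - 1 - i = 2 * m - i - 1 by omega,
        show (2 * (1 / 8) : ℚ) = 1 / 4 by norm_num]
    -- Only `i < m` survives: for index `m + i` the lower entry of the binomial coefficient exceeds
    -- the upper one.
    rw [← Finset.sum_congr rfl h1, two_mul, Finset.sum_range_add]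
    rw [add_eq_left]
    refine Finset.sum_eq_zero fun i _ => ?_
    rw [clfTail, Nat.choose_eq_zero_of_lt (n := 2 * m - (m + i) - 1) (by omega)]
    simp

section Tail

variable {p : ℕ} [hp : Fact p.Prime]

theorem prime_dvd_iff_zmod (z : ℤ) : (p : ℤ) ∣ z ↔ (z : ZMod p) = 0 :=
  (ZMod.intCast_zmod_eq_zero_iff_dvd z p).symm

/-- This is $\binom{2p-1}{p-1}\equiv1$, by Lucas. -/
theorem choose_two_mul_prime_sub_one {m : ℕ} (hm : p = 2 * m + 1) :
    (p : ℤ) ∣ ((4 * m + 1).choose (2 * m) : ℤ) - 1 := by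
  have h := @Choose.choose_modEq_choose_mod_mul_choose_div (4 * m + 1) (2 * m) p _
  have e1 : (4 * m + 1) % p = 2 * m := by
    rw [show 4 * m + 1 = 2 * m + p by omega, Nat.add_mod_right, Nat.mod_eq_of_lt (by omega)]
  have e2 : (2 * m) / p = 0 := Nat.div_eq_of_lt (by omega)
  rw [e1, e2, Nat.mod_eq_of_lt (by omega)] at h
  simp only [Nat.choose_self, Nat.choose_zero_right] at h
  exact h.symm.dvd

/-- Induction on `i`: consecutive ratios of the two sides are $p$-integral and agree modulo $p$, so
only the top term needs a direct computation. -/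
theorem clfTail_locModEq {m : ℕ} (hm : p = 2 * m + 1) (i : ℕ) (hi : i < m) :
    LocModEq p 1 (clfTail m i / (p : ℚ) ^ 2)
      ((-1) ^ (i + 1) / (2 * ((i + 1) ^ 2 * (m.choose (i + 1) : ℚ)))) := by
  have pp := Nat.prime_iff_prime_int.mp hp.out
  have hp0 : (p : ℚ) ≠ 0 := by exact_mod_cast hp.out.ne_zero
  have n2 : ¬ (p : ℤ) ∣ 2 := not_int_dvd_of_pos_of_lt (by omega) (by omega)
  induction i with
  | zero =>
    have hC := choose_two_mul_prime_sub_one hm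
    have n1 : ¬ (p : ℤ) ∣ (4 * m + 1) := by
      intro h
      refine not_int_dvd_of_pos_of_lt (p := p) (z := 2 * m) (by omega) (by omega) ?_
      have := dvd_sub h (dvd_refl (p : ℤ))
      rwa [show (4 * m + 1 - p : ℤ) = 2 * m by rw [hm]; push_cast; ring] at this
    have h4 : ((4 : ℤ) : ZMod p) ^ (2 * m) = 1 := by
      have := ZMod.pow_card_sub_one_eq_one (p := p) (a := ((4 : ℤ) : ZMod p)) (by
        rw [Ne, ← prime_dvd_iff_zmod]
        intro h
        exact (pp.dvd_mul.mp (show (p : ℤ) ∣ 2 * 2 by simpa using h)).elim n2 n2)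
      rwa [show p - 1 = 2 * m by omega] at this
    have h := LocModEq.int_div (p := p) (a := ((4 * m + 1).choose (2 * m) : ℤ) ^ 2)
      (b := (4 * m + 1) ^ 2 * 4 ^ (2 * m)) (c := -1) (d := 2 * m) (by
        intro h
        rcases pp.dvd_mul.mp h with h | h
        · exact n1 (pp.dvd_of_dvd_pow h)
        · have h := pp.dvd_of_dvd_pow h
          exact (pp.dvd_mul.mp (show (p : ℤ) ∣ 2 * 2 by simpa using h)).elim n2 n2)
      (not_int_dvd_of_pos_of_lt (by omega) (by omega)) (by
        rw [prime_dvd_iff_zmod] at hC ⊢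
        have hm' : (2 : ZMod p) * m = -1 := by
          have : ((2 * m + 1 : ℕ) : ZMod p) = 0 := by rw [← hm]; exact ZMod.natCast_self p
          push_cast at this
          linear_combination this
        push_cast at hC h4 ⊢
        rw [h4]
        linear_combination (2 * m) * (((4 * m + 1).choose (2 * m) : ZMod p) + 1) * hC
          + (8 * m + 1) * hm')
    convert h using 1
    -- The relation $(2p-1)\binom{2p-2}{p-1}=p\binom{2p-1}{p-1}$ extracts the factor $p$ that is
    -- squared in the summand.
    · have hc : ((4 * m + 1 : ℚ)) * ((4 * m).choose (2 * m) : ℚ)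
          = ((4 * m + 1).choose (2 * m) : ℚ) * p := by
        have := Nat.choose_mul_succ_eq (4 * m) (2 * m)
        rw [show 4 * m + 1 - 2 * m = p by omega] at this
        have : ((4 * m).choose (2 * m) : ℚ) * (4 * m + 1)
          = ((4 * m + 1).choose (2 * m) : ℚ) * p := by exact_mod_cast this
        linarith
      have hc' : ((4 * m).choose (2 * m) : ℚ)
          = ((4 * m + 1).choose (2 * m) : ℚ) * p / (4 * m + 1) := by
        field_simp
        linarith
      unfold clfTail
      simp only [Nat.sub_zero, Nat.choose_zero_right, ← mul_assoc]
      norm_num only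
      rw [hc']
      push_cast
      field_simp
      rw [mul_assoc, ← mul_pow]
      norm_num
    · simp
  | succ i ih =>
    obtain ⟨t, rfl⟩ : ∃ t, m = i + 2 + t := ⟨m - (i + 2), by omega⟩
    have hpz : (p : ℤ) = 2 * i + 2 * t + 5 := by rw [hm]; push_cast; ring
    have ih := ih (by omega)
    set K : ℕ := i + 2 + 2 * t with hK
    have hratio : clfTail (i + 2 + t) (i + 1) / (p : ℚ) ^ 2 = clfTail (i + 2 + t) i / (p : ℚ) ^ 2
        * ((-((K + 2) ^ 2 * (K + 1 - i) * (K - i)) : ℤ) / ((2 * K + 3) ^ 2 * (K + 1) * (i + 1) : ℤ)) := by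
      unfold clfTail
      rw [show 2 * (i + 2 + t) - i = K + 2 by omega,
        show 2 * (i + 2 + t) - (i + 1) = K + 1 by omega, show K + 2 - 1 = K + 1 by omega,
        show K + 1 - 1 = K by omega]
      have c1 := centralBinom_succ_rat (K + 1)
      have c2 : (K.choose (i + 1) : ℚ) = (K.choose i : ℚ) * (2 + 2 * t) / (i + 1) := by
        have := Nat.choose_succ_right_eq K i
        rw [show K - i = 2 + 2 * t by omega] at this
        have : (K.choose (i + 1) : ℚ) * (i + 1) = (K.choose i : ℚ) * (2 + 2 * t) := by
          exact_mod_cast this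
        field_simp
        linarith
      have c3 : ((K + 1).choose i : ℚ) = (K.choose i : ℚ) * (K + 1) / (3 + 2 * t) := by
        have := Nat.choose_mul_succ_eq K i
        rw [show K + 1 - i = 3 + 2 * t by omega] at this
        have : (K.choose i : ℚ) * (K + 1) = ((K + 1).choose i : ℚ) * (3 + 2 * t) := by
          exact_mod_cast this
        field_simp
        linarith
      rw [c1, c2, c3]
      have hKq : (K : ℚ) = i + 2 + 2 * t := by rw [hK]; push_cast; ring
      push_cast
      rw [show (K : ℚ) + 1 - i = 3 + 2 * t by rw [hKq]; ring,
        show (K : ℚ) - i = 2 + 2 * t by rw [hKq]; ring]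
      field_simp
      ring
    -- The factor $2(m-i-1)$ is written as $p-2i-3$, so that reduction modulo $p$ removes $m$.
    have htarget : ((-1) ^ (i + 1 + 1)
          / (2 * (((i + 1 : ℕ) + 1) ^ 2 * ((i + 2 + t).choose (i + 1 + 1) : ℚ))) : ℚ)
        = (-1) ^ (i + 1) / (2 * ((i + 1) ^ 2 * ((i + 2 + t).choose (i + 1) : ℚ)))
          * ((-(2 * (i + 1) ^ 2) : ℤ) / ((i + 2) * (p - 2 * i - 3) : ℤ)) := by
      have c2 : ((i + 2 + t).choose (i + 1 + 1) : ℚ)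
          = ((i + 2 + t).choose (i + 1) : ℚ) * (1 + t) / (i + 2) := by
        have := Nat.choose_succ_right_eq (i + 2 + t) (i + 1)
        rw [show i + 2 + t - (i + 1) = 1 + t by omega] at this
        have : ((i + 2 + t).choose (i + 1 + 1) : ℚ) * (i + 1 + 1)
            = ((i + 2 + t).choose (i + 1) : ℚ) * (1 + t) := by exact_mod_cast this
        field_simp
        linarith
      have p0 : ((i + 2 + t).choose (i + 1) : ℚ) ≠ 0 := by
        exact_mod_cast (Nat.choose_pos (by omega)).ne'
      rw [c2, hpz]
      push_cast
      rw [show (2 * (i : ℚ) + 2 * t + 5 - 2 * i - 3) = 2 * (1 + t) by ring,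
        show (i : ℚ) + 1 + 1 = i + 2 by ring]
      field_simp
      ring
    rw [hratio, htarget]
    have nD : ¬ (p : ℤ) ∣ (2 * K + 3) ^ 2 * (K + 1) * (i + 1) := by
      intro h
      rcases pp.dvd_mul.mp h with h | h
      · rcases pp.dvd_mul.mp h with h | h
        · have h := dvd_sub (pp.dvd_of_dvd_pow h) (dvd_refl (p : ℤ))
          exact not_int_dvd_of_pos_of_lt (p := p) (by omega) (by omega) h
        · exact not_int_dvd_of_pos_of_lt (p := p) (by omega) (by omega) h
      · exact not_int_dvd_of_pos_of_lt (p := p) (by omega) (by omega) h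
    have nD' : ¬ (p : ℤ) ∣ (i + 2) * (p - 2 * i - 3) := by
      intro h
      rcases pp.dvd_mul.mp h with h | h <;>
        exact not_int_dvd_of_pos_of_lt (p := p) (by omega) (by omega) h
    have hmem : ((-1) ^ (i + 1)
        / (2 * ((i + 1) ^ 2 * ((i + 2 + t).choose (i + 1) : ℚ))) : ℚ) ∈ pIntegral p := by
      have := int_div_mem_pIntegral (p := p) ((-1) ^ (i + 1))
        (z := 2 * ((i + 1) ^ 2 * ((i + 2 + t).choose (i + 1) : ℤ))) (by
          intro h
          rcases pp.dvd_mul.mp h with h | h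
          · exact n2 h
          rcases pp.dvd_mul.mp h with h | h
          · exact not_int_dvd_of_pos_of_lt (p := p) (by omega) (by omega) (pp.dvd_of_dvd_pow h)
          · have h : p ∣ (i + 2 + t).choose (i + 1) := by exact_mod_cast h
            have hf : p ∣ (i + 2 + t).factorial := by
              rw [← Nat.choose_mul_factorial_mul_factorial (n := i + 2 + t) (k := i + 1) (by omega)]
              exact (h.mul_right _).mul_right _
            have := hp.out.dvd_factorial.mp hf
            omega)
      push_cast at this
      exact this
    refine LocModEq.mul ih (LocModEq.int_div nD nD' ?_) (ih.mem hmem)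
      (int_div_mem_pIntegral _ nD')
    rw [prime_dvd_iff_zmod]
    have hKz : (K : ZMod p) = -(i + 3) := by
      have : ((K + (i + 3) : ℕ) : ZMod p) = 0 := by
        rw [show K + (i + 3) = p by omega]
        exact ZMod.natCast_self p
      push_cast at this
      linear_combination this
    push_cast
    rw [hKz, ZMod.natCast_self]
    ring

theorem sum_catalanLarcombeFrench_div_eight_locModEq {m : ℕ} (hm : p = 2 * m + 1) (h5 : 5 ≤ p) :
    LocModEq p 3 (∑ k ∈ Finset.range p, catalanLarcombeFrench k / (8 : ℚ) ^ k)
      (1 + 2 * (-1) ^ m * (p : ℚ) ^ 2 * (eulerNumber (p - 3) : ℚ)) := by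
  have hp0 : (p : ℚ) ≠ 0 := by exact_mod_cast hp.out.ne_zero
  rw [show Finset.range p = Finset.range (2 * m + 1) by rw [hm],
    sum_catalanLarcombeFrench_div_eight m (by omega)]
  have h1 : LocModEq p 1 (∑ i ∈ Finset.range m, clfTail m i / (p : ℚ) ^ 2)
      (2 * (-1) ^ m * (eulerNumber (p - 3) : ℚ)) := by
    refine (LocModEq.sum fun i hi => clfTail_locModEq hm i (Finset.mem_range.mp hi)).trans ?_
    have e : ∑ i ∈ Finset.range m, ((-1) ^ (i + 1) / (2 * ((i + 1) ^ 2 * (m.choose (i + 1) : ℚ))) : ℚ)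
        = ((2 : ℕ) : ℚ)⁻¹ * ∑ i ∈ Finset.range m, (1 / ((i : ℚ) + 1) ^ 2)
          + ∑ i ∈ Finset.range m, ((-1) ^ (i + 1) / ((i : ℚ) + 1) ^ 2) := by
      have := congrArg (fun x : ℚ => 2⁻¹ * x) (sum_neg_one_pow_div_sq_mul_choose m)
      simp only [Finset.mul_sum] at this
      rw [Finset.mul_sum, ← Finset.sum_add_distrib]
      refine Eq.trans (Finset.sum_congr rfl fun i _ => ?_)
        (this.trans (Finset.sum_congr rfl fun i _ => ?_))
      · generalize ((i : ℚ) + 1) ^ 2 * (m.choose (i + 1) : ℚ) = y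
        ring
      · push_cast
        ring
    rw [e]
    have := ((half_sum_inv_sq_locModEq_zero hm h5).mul_left
      (inv_natCast_mem_pIntegral_of_lt (p := p) (n := 2) (by omega) (by omega))).add
        (sum_alternating_inv_sq_locModEq hm h5)
    simpa using this
  have h2 := (LocModEq.refl (p := p) (r := 3) 1).add (h1.pow_mul_left (s := 2))
  convert h2 using 1
  · rw [← Finset.sum_div]
    field_simp
  · ring

end Tail

/-! ### Completing the truncated binomial sums at $1/16$ -/

theorem sum_choose_add_mul_half_pow (n : ℕ) :
    ∑ j ∈ Finset.range (n + 1), ((n + j).choose j : ℚ) * (1 / 2) ^ j = 2 ^ n := by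
  induction n with
  | zero => simp
  | succ n ih =>
    -- Pascal's rule reproduces the sum itself with factor 1/2; solving for it gives the doubling.
    have h1 : ∑ j ∈ Finset.range (n + 1 + 1), ((n + 1 + j).choose j : ℚ) * (1 / 2) ^ j
        = ∑ j ∈ Finset.range (n + 1 + 1), ((n + j).choose j : ℚ) * (1 / 2) ^ j
          + 1 / 2 * ∑ j ∈ Finset.range (n + 1), ((n + 1 + j).choose j : ℚ) * (1 / 2) ^ j := by
      have hs : ∑ j ∈ Finset.range (n + 1),
            ((n + 1 + (j + 1)).choose (j + 1) : ℚ) * (1 / 2) ^ (j + 1)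
          = ∑ j ∈ Finset.range (n + 1), ((n + (j + 1)).choose (j + 1) : ℚ) * (1 / 2) ^ (j + 1)
            + 1 / 2 * ∑ j ∈ Finset.range (n + 1), ((n + 1 + j).choose j : ℚ) * (1 / 2) ^ j := by
        rw [Finset.mul_sum, ← Finset.sum_add_distrib]
        refine Finset.sum_congr rfl fun j _ => ?_
        rw [show n + 1 + (j + 1) = n + 1 + j + 1 by omega, Nat.choose_succ_succ,
          show n + (j + 1) = n + 1 + j by omega]
        push_cast
        ring
      rw [Finset.sum_range_succ', Finset.sum_range_succ'
        (fun j => ((n + j).choose j : ℚ) * (1 / 2) ^ j), hs]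
      simp only [Nat.choose_zero_right]
      ring
    rw [Finset.sum_range_succ (fun j => ((n + j).choose j : ℚ) * (1 / 2) ^ j) (n + 1), ih] at h1
    have h2 := Finset.sum_range_succ (fun j => ((n + 1 + j).choose j : ℚ) * (1 / 2) ^ j) (n + 1)
    have h3 : ((n + 1 + (n + 1)).choose (n + 1) : ℚ) = 2 * ((n + (n + 1)).choose (n + 1) : ℚ) := by
      rw [show n + 1 + (n + 1) = n + (n + 1) + 1 by omega, Nat.choose_succ_succ,
        show (n + (n + 1)).choose n = (n + (n + 1)).choose (n + 1) from
          Nat.choose_symm_of_eq_add (by omega)]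
      push_cast
      ring
    rw [h3] at h2
    rw [pow_succ (1 / 2 : ℚ)] at h1 h2
    linear_combination 2 * h1 - h2

section Truncation

variable {p : ℕ} [hp : Fact p.Prime]

/-- Here $2m-i=p-1-i\equiv-(i+1)$, and upper negation applies while $j<p$. -/
theorem choose_sub_modEq {m : ℕ} (hm : p = 2 * m + 1) {i : ℕ} (hi : i < m) (j : ℕ) (hj : j ≤ i) :
    ((2 * m - i).choose j : ZMod p) = (-1) ^ j * ((i + j).choose j : ZMod p) := by
  induction j with
  | zero => simp
  | succ j ih =>
    have h0 : ((j : ZMod p) + 1) ≠ 0 := by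
      have := (prime_dvd_iff_zmod (p := p) (j + 1)).not.mp
        (not_int_dvd_of_pos_of_lt (by omega) (by omega))
      push_cast at this
      exact this
    have h1 : ((2 * m - i).choose (j + 1) : ZMod p) * (j + 1)
        = ((2 * m - i).choose j : ZMod p) * ((2 * m - i - j : ℕ) : ZMod p) := by
      have := congrArg (Nat.cast (R := ZMod p)) (Nat.choose_succ_right_eq (2 * m - i) j)
      push_cast at this ⊢
      exact this
    have h2 : ((i + (j + 1)).choose (j + 1) : ZMod p) * (j + 1)
        = (i + j + 1) * ((i + j).choose j : ZMod p) := by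
      have := congrArg (Nat.cast (R := ZMod p)) (Nat.add_one_mul_choose_eq (i + j) j)
      push_cast at this
      exact this.symm
    have h3 : ((2 * m - i - j : ℕ) : ZMod p) = -(i + j + 1) := by
      have : ((2 * m - i - j + (i + j + 1) : ℕ) : ZMod p) = 0 := by
        rw [show 2 * m - i - j + (i + j + 1) = p by omega]
        exact ZMod.natCast_self p
      rw [Nat.cast_add] at this
      push_cast at this ⊢
      linear_combination this
    apply mul_right_cancel₀ h0
    rw [h1, h3, ih (by omega)]
    linear_combination (-1) ^ j * h2

/-- Upper negation makes the signs cancel, giving $\sum_{j\le i}\binom{i+j}{j}2^{-j}=2^i$, which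
Fermat rewrites as $2^{-(2m-i)}$. -/
theorem truncated_binomial_locModEq {m : ℕ} (hm : p = 2 * m + 1) {i : ℕ} (hi : i < m) :
    LocModEq p 1 (∑ j ∈ Finset.range (i + 1), ((2 * m - i).choose j : ℚ) * (-1 / 2) ^ j)
      ((1 / 2) ^ (2 * m - i)) := by
  have n2 : ¬ (p : ℤ) ∣ 2 := not_int_dvd_of_pos_of_lt (by omega) (by omega)
  have pp := Nat.prime_iff_prime_int.mp hp.out
  have hhalf : (1 / 2 : ℚ) ∈ pIntegral p := by
    have := inv_natCast_mem_pIntegral_of_lt (p := p) (n := 2) (by omega) (by omega)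
    simpa using this
  have h1 : LocModEq p 1 (∑ j ∈ Finset.range (i + 1), ((2 * m - i).choose j : ℚ) * (-1 / 2) ^ j)
      (2 ^ i) := by
    rw [← sum_choose_add_mul_half_pow]
    refine LocModEq.sum fun j hj => ?_
    have hj' := Finset.mem_range.mp hj
    have h := (LocModEq.of_int_dvd (p := p) (a := ((2 * m - i).choose j : ℤ))
      (b := (-1) ^ j * ((i + j).choose j : ℤ)) (by
        rw [prime_dvd_iff_zmod]
        push_cast
        rw [choose_sub_modEq hm hi j (by omega), sub_self])).mul_left
      (pow_mem (neg_mem hhalf) j)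
    convert h using 1
    · rw [mul_comm]
      norm_num
    · push_cast
      rw [neg_pow]
      have : (-1 : ℚ) ^ j * (-1) ^ j = 1 := by rw [← mul_pow]; norm_num
      linear_combination -(((i + j).choose j : ℚ) * (1 / 2) ^ j) * this
  refine h1.trans ?_
  have h2 := LocModEq.int_div (p := p) (a := 2 ^ i) (b := 1) (c := 1) (d := 2 ^ (2 * m - i))
    (by exact_mod_cast hp.out.not_dvd_one) (fun h => n2 (pp.dvd_of_dvd_pow h)) (by
      rw [← pow_add, show i + (2 * m - i) = p - 1 by omega, prime_dvd_iff_zmod]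
      push_cast
      rw [ZMod.pow_card_sub_one_eq_one, sub_self]
      have := (prime_dvd_iff_zmod (p := p) 2).not.mp n2
      exact_mod_cast this)
  push_cast at h2
  convert h2 using 1
  · rw [div_one]
  · rw [div_pow, one_pow]

theorem prime_dvd_centralBinom {m : ℕ} (hm : p = 2 * m + 1) {k : ℕ} (h1 : m < k) (h2 : k < p) :
    p ∣ (2 * k).choose k := by
  have h := Nat.choose_mul_factorial_mul_factorial (n := 2 * k) (k := k) (by omega)
  have hd : p ∣ (2 * k).factorial := hp.out.dvd_factorial.mpr (by omega)
  rw [← h, show 2 * k - k = k by omega] at hd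
  have hk : ¬ p ∣ k.factorial := fun h => absurd (hp.out.dvd_factorial.mp h) (by omega)
  exact (hp.out.dvd_mul.mp ((hp.out.dvd_mul.mp hd).resolve_right hk)).resolve_right hk

theorem sum_catalanLarcombeFrench_div_sixteen_locModEq_sum {m : ℕ} (hm : p = 2 * m + 1)
    (h3 : 3 ≤ p) :
    LocModEq p 3 (∑ k ∈ Finset.range p, catalanLarcombeFrench k / (16 : ℚ) ^ k)
      (∑ k ∈ Finset.range p, ((2 * k).choose k : ℚ) ^ 2 * (1 / 16) ^ k) := by
  have h0 : ∑ k ∈ Finset.range p, catalanLarcombeFrench k / (16 : ℚ) ^ k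
      = ∑ k ∈ Finset.range p, catalanLarcombeFrench k * (1 / 16) ^ k :=
    Finset.sum_congr rfl fun k _ => by rw [div_pow, one_pow, mul_one_div]
  rw [h0, sum_catalanLarcombeFrench]
  refine LocModEq.sum fun k hk => ?_
  have hk' := Finset.mem_range.mp hk
  rw [show (2 * (1 / 16) : ℚ) = 1 / 8 by norm_num, show (-8 * (1 / 16) : ℚ) = -1 / 2 by norm_num]
  have h16 : (1 / 16 : ℚ) ^ k = (1 / 8) ^ k * (1 / 2) ^ k := by rw [← mul_pow]; norm_num
  rw [h16, mul_assoc]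
  rcases le_or_gt k m with hkm | hkm
  · refine LocModEq.of_eq ?_
    congr 2
    rw [show (1 / 2 : ℚ) = -1 / 2 + 1 by norm_num, add_pow]
    simp only [one_pow, mul_one]
    -- For `k ≤ m` the cutoff lies beyond the whole binomial expansion, so equality is exact.
    rw [show p - k = k + 1 + (2 * m - 2 * k) by omega, Finset.sum_range_add]
    rw [Finset.sum_eq_zero (s := Finset.range (2 * m - 2 * k)), add_zero]
    · exact Finset.sum_congr rfl fun j _ => mul_comm _ _
    · intro j _
      rw [Nat.choose_eq_zero_of_lt (by omega)]
      simp
  · obtain ⟨i, hi, rfl⟩ : ∃ i, i < m ∧ k = 2 * m - i := ⟨2 * m - k, by omega, by omega⟩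
    obtain ⟨c, hc⟩ := prime_dvd_centralBinom hm hkm hk'
    have hint : (c : ℚ) ^ 2 * (1 / 8) ^ (2 * m - i) ∈ pIntegral p := by
      have h8 : ((8 : ℕ) : ℚ)⁻¹ ∈ pIntegral p := by
        refine inv_natCast_mem_pIntegral fun h => ?_
        have := Nat.le_of_dvd (by norm_num) (hp.out.dvd_of_dvd_pow (show p ∣ 2 ^ 3 from h))
        omega
      refine mul_mem (pow_mem (natCast_mem _ _) _) (pow_mem ?_ _)
      simpa using h8
    have h := ((truncated_binomial_locModEq hm hi).mul_left hint).pow_mul_left (s := 2)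
    rw [hc, show p - (2 * m - i) = i + 1 by omega]
    convert h using 1 <;> push_cast <;> ring

end Truncation

/-! ### Interpolation in $a$ from $-p/2$ to $-1/2$ -/

section Interpolation

/-- The product `C(a,k) C(-1-a,k)` of generalized binomial coefficients. -/
def legendreTerm (k : ℕ) (a : ℚ) : ℚ :=
  ∏ i ∈ Finset.range k, ((i - a) * (i + 1 + a) / ((i : ℚ) + 1) ^ 2)

/-- The truncated sine product `∏_{i=1}^N (1 - a^2/i^2)`. -/
def sineProd (N : ℕ) (a : ℚ) : ℚ :=
  ∏ i ∈ Finset.range N, (1 - a ^ 2 / ((i : ℚ) + 1) ^ 2)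

theorem legendreTerm_neg_half (k : ℕ) :
    legendreTerm k (-1 / 2) = ((2 * k).choose k : ℚ) ^ 2 * (1 / 16) ^ k := by
  induction k with
  | zero => simp [legendreTerm]
  | succ k ih =>
    rw [legendreTerm, Finset.prod_range_succ, ← legendreTerm, ih, centralBinom_succ_rat]
    field_simp
    ring

theorem legendreTerm_sub_one (k : ℕ) (a : ℚ) : legendreTerm k (a - 1) = legendreTerm k (-a) := by
  unfold legendreTerm
  refine Finset.prod_congr rfl fun i _ => ?_
  congr 1
  ring

theorem sineProd_neg (N : ℕ) (a : ℚ) : sineProd N (-a) = sineProd N a := by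
  simp [sineProd]

theorem sineProd_succ (N : ℕ) (a : ℚ) :
    sineProd (N + 1) a = sineProd N a * (1 - a ^ 2 / ((N : ℚ) + 1) ^ 2) :=
  Finset.prod_range_succ _ _

/-- Regrouping the factors $(i-a)(i+1+a)$ as $(i-a)(i+a)$ leaves the end factors $-a$ and $N+1+a$.
-/
theorem legendreTerm_succ (N : ℕ) (a : ℚ) :
    legendreTerm (N + 1) a = -a * (N + 1 + a) / ((N : ℚ) + 1) ^ 2 * sineProd N a := by
  induction N with
  | zero => simp [legendreTerm, sineProd]
  | succ N ih =>
    rw [legendreTerm, Finset.prod_range_succ, ← legendreTerm, ih, sineProd_succ]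
    push_cast
    field_simp
    ring

/-- The reflection $a-1\mapsto-a$ fixes each term, so the two new terms share a sine product and add
up to twice its increment. -/
theorem sum_legendreTerm_add_sub_one (N : ℕ) (a : ℚ) :
    ∑ k ∈ Finset.range (N + 1), legendreTerm k a + ∑ k ∈ Finset.range (N + 1), legendreTerm k (a - 1)
      = 2 * sineProd N a := by
  induction N with
  | zero => norm_num [legendreTerm, sineProd]
  | succ N ih =>
    rw [Finset.sum_range_succ, Finset.sum_range_succ _ (N + 1), legendreTerm_sub_one (N + 1),
      legendreTerm_succ, legendreTerm_succ, sineProd_neg, sineProd_succ]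
    have : (-a * (N + 1 + a) / ((N : ℚ) + 1) ^ 2 * sineProd N a)
        + (- -a * (N + 1 + -a) / ((N : ℚ) + 1) ^ 2 * sineProd N a)
        = -2 * (a ^ 2 / ((N : ℚ) + 1) ^ 2) * sineProd N a := by
      field_simp
      ring
    linear_combination ih + this

/-- A unit shift changes only the end factors of $\prod(i-a)(i+a)$; the cross-multiplied form also
covers their zeros. -/
theorem sineProd_add_one (N : ℕ) (a : ℚ) :
    (a + 1) * (a - N) * sineProd N (a + 1) = a * (a + N + 1) * sineProd N a := by
  induction N with
  | zero => simp [sineProd]; ring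
  | succ N ih =>
    rw [sineProd_succ, sineProd_succ]
    have e : ∀ x : ℚ, 1 - x ^ 2 / ((N : ℚ) + 1) ^ 2 = (N + 1 - x) * (N + 1 + x) / ((N : ℚ) + 1) ^ 2 := by
      intro x
      field_simp
      ring
    rw [e, e]
    push_cast
    linear_combination ((N + 1 - a) * (N + 2 + a) / ((N : ℚ) + 1) ^ 2) * ih

variable {p : ℕ} [hp : Fact p.Prime]

theorem sineProd_half_prime_locModEq (h3 : 3 ≤ p) (N : ℕ) (hN : N < p) :
    LocModEq p 2 (sineProd N (-p / 2)) 1 := by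
  induction N with
  | zero => simpa [sineProd] using LocModEq.refl 1
  | succ N ih =>
    rw [sineProd_succ, ← mul_one (1 : ℚ)]
    refine LocModEq.mul (ih (by omega)) ?_ ((ih (by omega)).mem (one_mem _)) (one_mem _)
    refine ⟨-((((2 : ℕ) : ℚ)⁻¹) ^ 2 * (((N + 1 : ℕ) : ℚ)⁻¹) ^ 2), neg_mem (mul_mem
      (pow_mem (inv_natCast_mem_pIntegral_of_lt (by omega) (by omega)) _)
      (pow_mem (inv_natCast_mem_pIntegral_of_lt (by omega) (by omega)) _)), ?_⟩
    push_cast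
    field_simp
    ring

/-- The first shift, from $-p/2$ to $1-p/2$, produces $p^2$ through $a(a+p)=-p^2/4$. Each later one
multiplies by $(j+1)^2/(j+2)^2$ modulo $p$. -/
theorem sineProd_shift_locModEq {m : ℕ} (hm : p = 2 * m + 1) (j : ℕ) (hj : j < m) :
    LocModEq p 1 (sineProd (2 * m) (j + 1 - p / 2) / (p : ℚ) ^ 2)
      ((-1 : ℤ) / ((4 * (j + 1) ^ 2 : ℤ) : ℚ)) := by
  have pp := Nat.prime_iff_prime_int.mp hp.out
  have hp0 : (p : ℚ) ≠ 0 := by exact_mod_cast hp.out.ne_zero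
  have n2 : ¬ (p : ℤ) ∣ 2 := not_int_dvd_of_pos_of_lt (by omega) (by omega)
  have hmq : (p : ℚ) = 2 * m + 1 := by rw [hm]; push_cast; ring
  have n4 : ∀ j : ℕ, j < m → ¬ (p : ℤ) ∣ 4 * (j + 1) ^ 2 := by
    intro j hj h
    rcases pp.dvd_mul.mp h with h | h
    · exact (pp.dvd_mul.mp (show (p : ℤ) ∣ 2 * 2 by simpa using h)).elim n2 n2
    · exact not_int_dvd_of_pos_of_lt (p := p) (by omega) (by omega) (pp.dvd_of_dvd_pow h)
  have nd : ∀ j : ℕ, j < m → ¬ (p : ℤ) ∣ (2 * j + 2 - p) * (2 * j + 2 - 3 * p) := by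
    intro j hj h
    have h2 : (p : ℤ) ∣ 4 * (j + 1) ^ 2 := by
      rw [prime_dvd_iff_zmod] at h ⊢
      push_cast at h ⊢
      rw [ZMod.natCast_self] at h
      linear_combination h
    exact n4 j hj h2
  induction j with
  | zero =>
    have hs := sineProd_add_one (2 * m) (-p / 2)
    have d := nd 0 hj
    have h1 := LocModEq.int_div (p := p) (a := -1) (b := (2 * (0 : ℕ) + 2 - p) * (2 * (0 : ℕ) + 2 - 3 * p))
      (c := -1) (d := 4 * ((0 : ℕ) + 1) ^ 2) d (n4 0 hj) ⟨-8 + 3 * p, by push_cast; ring⟩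
    have hQ : LocModEq p 1 (sineProd (2 * m) (-p / 2)) 1 := by
      obtain ⟨c, hc, h⟩ := sineProd_half_prime_locModEq (p := p) (by omega) (2 * m) (by omega)
      exact ⟨p * c, mul_mem (natCast_mem _ _) hc, by rw [h]; ring⟩
    have h2 := LocModEq.mul hQ h1 (hQ.mem (one_mem _)) (int_div_mem_pIntegral _ (n4 0 hj))
    have d' : ((2 - p : ℚ) * (2 - 3 * p)) ≠ 0 := by
      intro h
      apply d
      have : ((2 - p : ℤ) * (2 - 3 * p)) = 0 := by exact_mod_cast h
      simp [this]
    convert h2 using 1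
    · push_cast
      have d1 := left_ne_zero_of_mul d'
      have d2 := right_ne_zero_of_mul d'
      rw [show (0 : ℚ) + 1 - p / 2 = -p / 2 + 1 by ring]
      have e : sineProd (2 * m) (-p / 2 + 1) * ((2 - p : ℚ) * (2 - 3 * p))
          = -p ^ 2 * sineProd (2 * m) (-p / 2) := by
        push_cast at hs
        linear_combination 4 * hs + (2 * (2 - p : ℚ) * sineProd (2 * m) (-p / 2 + 1)
          - 2 * p * sineProd (2 * m) (-p / 2)) * (-hmq)
      rw [← eq_div_iff d'] at e
      rw [e]
      field_simp
    · rw [one_mul]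
  | succ j ih =>
    have hs := sineProd_add_one (2 * m) (j + 1 - p / 2)
    have d := nd (j + 1) hj
    have h1 := LocModEq.int_div (p := p) (a := (2 * j + 2 - p) * (2 * j + 2 + p))
      (b := (2 * (j + 1 : ℕ) + 2 - p) * (2 * (j + 1 : ℕ) + 2 - 3 * p))
      (c := 4 * (j + 1) ^ 2) (d := 4 * ((j + 1 : ℕ) + 1) ^ 2) d (n4 (j + 1) hj) (by
        rw [prime_dvd_iff_zmod]
        push_cast
        rw [ZMod.natCast_self]
        ring)
    have h2 := LocModEq.mul (ih (by omega)) h1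
      ((ih (by omega)).mem (int_div_mem_pIntegral _ (n4 j (by omega))))
      (int_div_mem_pIntegral _ (n4 (j + 1) hj))
    have d' : ((2 * (j + 1) + 2 - p : ℚ) * (2 * (j + 1) + 2 - 3 * p)) ≠ 0 := by
      intro h
      apply d
      have : ((2 * (j + 1) + 2 - p : ℤ) * (2 * (j + 1) + 2 - 3 * p)) = 0 := by exact_mod_cast h
      push_cast
      rw [this]
      exact dvd_zero _
    convert h2 using 1
    · push_cast
      have d1 := left_ne_zero_of_mul d'
      have d2 := right_ne_zero_of_mul d'
      rw [show (j : ℚ) + 1 + 1 - p / 2 = j + 1 - p / 2 + 1 by ring]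
      have e : sineProd (2 * m) (j + 1 - p / 2 + 1)
            * ((2 * (j + 1) + 2 - p : ℚ) * (2 * (j + 1) + 2 - 3 * p))
          = (2 * j + 2 - p) * (2 * j + 2 + p) * sineProd (2 * m) (j + 1 - p / 2) := by
        push_cast at hs
        linear_combination 4 * hs + (2 * (2 * (j + 1) + 2 - p : ℚ)
          * sineProd (2 * m) (j + 1 - p / 2 + 1)
          + 2 * (2 * j + 2 - p) * sineProd (2 * m) (j + 1 - p / 2)) * (-hmq)
      rw [← eq_div_iff d'] at e
      rw [e]
      field_simp
    · push_cast
      have : (4 * ((j : ℚ) + 1) ^ 2) ≠ 0 := by positivity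
      field_simp

/-- At $a=-p/2$ each term with $k\ge1$ carries a factor $p$, so its sine product is needed only
modulo $p^2$, where it is 1. What remains is $\frac p2\sum\frac1k-\frac{p^2}4\sum\frac1{k^2}$. -/
theorem sum_legendreTerm_half_prime_locModEq {m : ℕ} (hm : p = 2 * m + 1) (h5 : 5 ≤ p) :
    LocModEq p 3 (∑ k ∈ Finset.range p, legendreTerm k (-p / 2)) 1 := by
  have hhalf := inv_natCast_mem_pIntegral_of_lt (p := p) (n := 2) (by omega) (by omega)
  have hterm : ∀ k ∈ Finset.range (p - 1), LocModEq p 3 (legendreTerm (k + 1) (-p / 2))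
      ((p : ℚ) ^ 1 * (((2 : ℕ) : ℚ)⁻¹ * (1 / ((k : ℚ) + 1)))
        - (p : ℚ) ^ 2 * ((((2 : ℕ) : ℚ)⁻¹) ^ 2 * (1 / ((k : ℚ) + 1) ^ 2))) := by
    intro k hk
    have hk' := Finset.mem_range.mp hk
    have hinv := inv_natCast_mem_pIntegral_of_lt (p := p) (n := k + 1) (by omega) (by omega)
    rw [legendreTerm_succ]
    have h := ((sineProd_half_prime_locModEq (p := p) (by omega) k (by omega)).mul_left
      (z := ((2 : ℕ) : ℚ)⁻¹ * ((k + 1 : ℕ) : ℚ)⁻¹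
        - p * ((((2 : ℕ) : ℚ)⁻¹) ^ 2 * (((k + 1 : ℕ) : ℚ)⁻¹) ^ 2))
      (sub_mem (mul_mem hhalf hinv) (mul_mem (natCast_mem _ _)
        (mul_mem (pow_mem hhalf _) (pow_mem hinv _))))).pow_mul_left (s := 1)
    convert h using 1
    · push_cast
      field_simp
      ring
    · push_cast
      field_simp
  have hsum := LocModEq.sum hterm
  rw [Finset.sum_sub_distrib] at hsum
  simp only [← Finset.mul_sum] at hsum
  have z1 := ((sum_inv_locModEq_zero hm h5).mul_left hhalf).pow_mul_left (s := 1)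
  have z2 := ((sum_inv_sq_locModEq_zero h5).mul_left (pow_mem hhalf 2)).pow_mul_left (s := 2)
  have h := (hsum.trans (z1.sub z2)).add (LocModEq.refl 1)
  rw [show Finset.range p = Finset.range (p - 1 + 1) by rw [Nat.sub_add_cancel hp.out.one_le],
    Finset.sum_range_succ']
  convert h using 1
  · simp [legendreTerm]
  · ring

theorem sum_legendreTerm_shift_locModEq {m : ℕ} (hm : p = 2 * m + 1) (h5 : 5 ≤ p) (j : ℕ)
    (hj : j ≤ m) :
    LocModEq p 3 (∑ k ∈ Finset.range p, legendreTerm k (j - p / 2))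
      ((-1) ^ j * (1 - (p : ℚ) ^ 2 * (1 / 2 *
        ∑ i ∈ Finset.range j, ((-1) ^ (i + 1) / ((i : ℚ) + 1) ^ 2)))) := by
  have hp0 : (p : ℚ) ≠ 0 := by exact_mod_cast hp.out.ne_zero
  induction j with
  | zero =>
    simpa [neg_div] using sum_legendreTerm_half_prime_locModEq hm h5
  | succ j ih =>
    have h := sum_legendreTerm_add_sub_one (2 * m) ((j + 1 : ℕ) - p / 2)
    rw [← hm, show ((j + 1 : ℕ) : ℚ) - p / 2 - 1 = j - p / 2 by push_cast; ring] at h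
    rw [eq_sub_of_add_eq h]
    have h1 := (((sineProd_shift_locModEq hm j (by omega)).mul_left
      (natCast_mem (pIntegral p) 2)).pow_mul_left (s := 2)).sub (ih (by omega))
    convert h1 using 1
    · push_cast
      field_simp
    · rw [Finset.sum_range_succ]
      push_cast
      have : (-1 : ℚ) ^ j * (-1) ^ j = 1 := by rw [← mul_pow]; norm_num
      rw [div_mul_eq_div_div, pow_succ (-1 : ℚ)]
      generalize ((j : ℚ) + 1) ^ 2 = y
      linear_combination (-(p : ℚ) ^ 2 / 2 / y) * this

theorem sum_catalanLarcombeFrench_div_sixteen_locModEq {m : ℕ} (hm : p = 2 * m + 1) (h5 : 5 ≤ p) :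
    LocModEq p 3 (∑ k ∈ Finset.range p, catalanLarcombeFrench k / (16 : ℚ) ^ k)
      ((-1) ^ m - (p : ℚ) ^ 2 * (eulerNumber (p - 3) : ℚ)) := by
  have hmq : (p : ℚ) = 2 * m + 1 := by rw [hm]; push_cast; ring
  refine (sum_catalanLarcombeFrench_div_sixteen_locModEq_sum hm (by omega)).trans ?_
  have h := sum_legendreTerm_shift_locModEq hm h5 m le_rfl
  rw [show (m : ℚ) - p / 2 = -1 / 2 by rw [hmq]; ring] at h
  simp only [legendreTerm_neg_half] at h
  refine h.trans ?_
  have hhalf := inv_natCast_mem_pIntegral_of_lt (p := p) (n := 2) (by omega) (by omega)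
  have h2 := (((sum_alternating_inv_sq_locModEq hm h5).mul_left
    (mul_mem (pow_mem (neg_mem (one_mem _)) m) hhalf)).pow_mul_left (s := 2))
  have h3 := (LocModEq.refl (p := p) (r := 3) ((-1) ^ m)).sub h2
  have hsq : (-1 : ℚ) ^ m * (-1) ^ m = 1 := by rw [← mul_pow]; norm_num
  convert h3 using 1
  · push_cast
    ring
  · push_cast
    linear_combination ((p : ℚ) ^ 2 * eulerNumber (p - 3)) * hsq

end Interpolation

/-! ### The theorem, with $p=3$ treated separately -/

theorem theorem1p2 (p : ℕ) [Fact p.Prime] (hp : Odd p) :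
    RatModEq (p ^ 3)
        (∑ k ∈ Finset.range p, catalanLarcombeFrench k / (8 : ℚ) ^ k)
        (1 + 2 * (legendreSym p (-1) : ℚ) * (p : ℚ) ^ 2 * (eulerNumber (p - 3) : ℚ)) ∧
      RatModEq (p ^ 3)
        (∑ k ∈ Finset.range p, catalanLarcombeFrench k / (16 : ℚ) ^ k)
        ((legendreSym p (-1) : ℚ) - (p : ℚ) ^ 2 * (eulerNumber (p - 3) : ℚ)) := by
  obtain ⟨m, hm⟩ := hp
  have h2 : 2 ≤ p := (Fact.out : p.Prime).two_le
  have hleg : (legendreSym p (-1) : ℚ) = (-1) ^ m := by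
    rw [legendreSym.at_neg_one (by omega), ZMod.χ₄_eq_neg_one_pow (by omega),
      show p / 2 = m by omega]
    push_cast
    rfl
  rw [hleg]
  rcases Nat.lt_or_ge p 5 with h5 | h5
  -- At $p=3$ the vanishing of the inverse-square sum fails. Direct computation gives differences
  -- $81/4=27\cdot\frac34$ and $189/16=27\cdot\frac7{16}$.
  · obtain rfl : m = 1 := by omega
    obtain rfl : p = 3 := by omega
    have c0 : catalanLarcombeFrench 0 = 1 := by simp [catalanLarcombeFrench]
    have c1 : catalanLarcombeFrench 1 = 8 := by
      norm_num [catalanLarcombeFrench, Finset.sum_range_succ, Nat.choose]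
    have c2 : catalanLarcombeFrench 2 = 80 := by
      norm_num [catalanLarcombeFrench, Finset.sum_range_succ, Nat.choose]
    have e0 : eulerNumber 0 = 1 := by simp [eulerNumber]
    simp only [Finset.sum_range_succ, Finset.sum_range_zero, c0, c1, c2, Nat.sub_self, e0]
    constructor
    · exact ⟨3 / 4, by norm_num, by norm_num⟩
    · exact ⟨7 / 16, by norm_num, by norm_num⟩
  · exact ⟨(sum_catalanLarcombeFrench_div_eight_locModEq hm h5).ratModEq,
      (sum_catalanLarcombeFrench_div_sixteen_locModEq hm h5).ratModEq⟩
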